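/- A Banach space $X$ is called uniformly finitely extensible (UFO) if there is $\lambda\ge 1$ such that for every finite dimensional subspace $E\subset X$, every linear operator $t:E\to X$ extends to a bounded linear operator $T:X\to X$ with $\|T\|\le\lambda\|t\|$. For separable Banach spaces $W,Z$, let $\mathrm{Emb}(W,Z)$ be the set of bounded linear operators $W\to Z$ which are isomorphisms onto their range, the range having infinite codimension in $Z$. It is equipped with the Borel structure generated by the strong operator topology. For $T,U\in\mathrm{Emb}(W,Z)$ write $T\sim U$ if there is an automorphism (bounded linear bijection with bounded inverse) $A$ of $Z$ with $T=AU$; the $\sim$-classes are the positions of $W$ in $Z$. Let $E_1$ be the relation of eventual agreement on $\mathbb{R}^{\mathbb{N}}$: $x\,E_1\,y$ iff there is $n$ with $x_m=y_m$ for all $m\ge n$. An equivalence relation $R$ on $E$ is Borel reducible to $S$ on $F$ if there is a Borel map $f:E\to F$ with $x\,R\,y\Leftrightarrow f(x)\,S\,f(y)$ for all $x,y\in E$. Finally, $\ell_p(X)$ denotes the space of $p$-summable sequences in $X$ and $c_0(X)$ the space of null sequences in $X$, with their usual norms. **Corollary.** Let $X$ be a separable (real or complex) Banach space which is not uniformly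 finitely extensible. Then there is a closed infinite dimensional subspace $Y\subset X$ such that $E_1$ is Borel reducible to $(\mathrm{Emb}(\ell_p(Y),\ell_p(X)),\sim)$ for every $1\le p<\infty$, and $E_1$ is Borel reducible to $(\mathrm{Emb}(c_0(Y),c_0(X)),\sim)$. -/

import Mathlib

open scoped ENNReal ZeroAtInfty

/-- A Banach space `X` is uniformly finitely extensible (UFO) if for some `C ≥ 1`, every (automatically
bounded) linear operator `t : E → X` on a finite dimensional subspace `E` of `X` extends to an
operator `T : X → X` with `‖T‖ ≤ C * ‖t‖`. -/
def IsUFO (𝕜 : Type*) (X : Type*) [RCLike 𝕜] [NormedAddCommGroup X] [NormedSpace 𝕜 X] : Prop :=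
  ∃ C : ℝ, 1 ≤ C ∧ ∀ E : Submodule 𝕜 X, FiniteDimensional 𝕜 E → ∀ t : E →L[𝕜] X,
    ∃ T : X →L[𝕜] X, (∀ e : E, T (e : X) = t e) ∧ ‖T‖ ≤ C * ‖t‖

section Positions

variable (𝕜 : Type*) (Y X : Type*) [RCLike 𝕜]
  [NormedAddCommGroup Y] [NormedSpace 𝕜 Y] [NormedAddCommGroup X] [NormedSpace 𝕜 X]

/-- The Borel structure on the space `B(Y, X)` of bounded operators that is generated by the strong
operator topology (the topology of pointwise convergence). -/
instance sotMeasurableSpace : MeasurableSpace (Y →Lₚₜ[𝕜] X) := borel _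

instance sotBorelSpace : BorelSpace (Y →Lₚₜ[𝕜] X) := ⟨rfl⟩

/-- `Emb(Y, X)`: the bounded linear operators `Y → X` that are isomorphisms onto their range, the
range being of infinite codimension in `X`. As a subset of `B(Y, X)` it carries the induced Borel
structure. -/
def Emb : Set (Y →Lₚₜ[𝕜] X) :=
  {T | Topology.IsEmbedding (fun y : Y => T y) ∧
    ¬ FiniteDimensional 𝕜 (X ⧸ LinearMap.range (T : Y →ₗ[𝕜] X))}

/-- Equivalence of positions: `T ∼ U` if and only if `T = A U` for some automorphism `A` of `X`. -/
def positionSetoid : Setoid (Emb 𝕜 Y X) where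
  r T U := ∃ A : X ≃L[𝕜] X, ∀ y : Y, T.1 y = A (U.1 y)
  iseqv :=
    { refl := fun _ => ⟨ContinuousLinearEquiv.refl 𝕜 X, fun _ => rfl⟩
      symm := fun ⟨A, h⟩ => ⟨A.symm, fun y => by rw [h y, A.symm_apply_apply]⟩
      trans := fun ⟨A, h⟩ ⟨B, k⟩ => ⟨B.trans A, fun y => by rw [h y, k y]; rfl⟩ }

end Positions

/-- Borel reducibility `(α, r) ≤_B (β, s)` of equivalence relations. -/
def BorelReducible {α β : Type*} [MeasurableSpace α] [MeasurableSpace β]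
    (r : Setoid α) (s : Setoid β) : Prop :=
  ∃ f : α → β, Measurable f ∧ ∀ x y : α, r x y ↔ s (f x) (f y)

/-- `E₁`: eventual agreement of sequences of real numbers. -/
def E₁ : Setoid (ℕ → ℝ) where
  r x y := ∃ n : ℕ, ∀ m ≥ n, x m = y m
  iseqv :=
    { refl := fun _ => ⟨0, fun _ _ => rfl⟩
      symm := fun ⟨n, h⟩ => ⟨n, fun m hm => (h m hm).symm⟩
      trans := fun ⟨n, h⟩ ⟨k, g⟩ => ⟨max n k, fun m hm =>
        (h m (le_trans (le_max_left _ _) hm)).trans (g m (le_trans (le_max_right _ _) hm))⟩ }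

/-- `ℓ_p(X)`: the `p`-summable sequences in `X`. -/
abbrev SeqLp (p : ℝ≥0∞) (X : Type*) [NormedAddCommGroup X] : Type _ := lp (fun _ : ℕ => X) p

/-- `c₀(X)`: the null sequences in `X` with the supremum norm. -/
abbrev SeqC0 (X : Type*) [NormedAddCommGroup X] : Type _ := C₀(ℕ, X)

/-! Failure of uniform extension survives on finite codimensional subspaces
(`HasFiniteExtensions.of_inf_iInf_ker`). Hence finite dimensional blocks `E n`, with operators on
them whose extensions to `X` all have norm above `n`, can be chosen successively so that projections
onto blocks are uniformly bounded. Their closed span is `Y`. Extending the `n`-th operator by zero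
on the other blocks gives `s n : Y → X` of norm at most 1 that extends to `X`, but only with norm
above `n` (`exists_subspace_of_not_isUFO`).

A binary sequence `α` is coded by the operator sending `(y j)` to the sequence with `y j` at place
`2 * j` and `α j • s m (y j)` at place `2 * j + 1`, where `m = j.unpair.1`; the digits of the real
`x m` occupy exactly the `j` with this `m`. If `x` and `y` eventually agree, the codes differ
through finitely many `s m`, and a bounded shear built from their extensions maps one code to the
other. Conversely, an automorphism `A` relating the codes yields, at any differing digit, an
extension of `s m` of norm at most `‖A‖` or `‖A⁻¹‖`, so `m` is bounded. Digits are Borel in `x`, and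
the code is continuous in `α` for the strong operator topology. -/

/-! ### Uniform extension and finite codimension -/

section FiniteExtension

variable {𝕜 X : Type*} [RCLike 𝕜] [NormedAddCommGroup X] [NormedSpace 𝕜 X]

/-- Operators into `X` from finite dimensional subspaces of `Z` extend to `X` with a uniform bound. -/
def HasFiniteExtensions (Z : Submodule 𝕜 X) : Prop :=
  ∃ C : ℝ, 0 ≤ C ∧ ∀ E : Submodule 𝕜 X, E ≤ Z → FiniteDimensional 𝕜 E → ∀ t : E →L[𝕜] X,
    ∃ T : X →L[𝕜] X, (∀ e : E, T (e : X) = t e) ∧ ‖T‖ ≤ C * ‖t‖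

theorem HasFiniteExtensions.isUFO (h : HasFiniteExtensions (⊤ : Submodule 𝕜 X)) : IsUFO 𝕜 X := by
  obtain ⟨C, -, hC⟩ := h
  refine ⟨max C 1, le_max_right _ _, fun E hE t => ?_⟩
  obtain ⟨T, hT, hn⟩ := hC E le_top hE t
  exact ⟨T, hT, hn.trans (by gcongr; exact le_max_left _ _)⟩

/-- Extend `t` first from `E ⊓ ker φ`. The error `d` vanishes on `ker φ`, so it has rank at most
one, and Hahn–Banach extends it without increasing its norm. -/
theorem HasFiniteExtensions.of_inf_ker {Z : Submodule 𝕜 X} (φ : StrongDual 𝕜 X)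
    (h : HasFiniteExtensions (Z ⊓ LinearMap.ker (φ : X →ₗ[𝕜] 𝕜))) : HasFiniteExtensions Z := by
  obtain ⟨C, hC0, hC⟩ := h
  refine ⟨C + (1 + C), by positivity, fun E hEZ hE t => ?_⟩
  set E₀ : Submodule 𝕜 X := E ⊓ LinearMap.ker (φ : X →ₗ[𝕜] 𝕜)
  have hE₀ : FiniteDimensional 𝕜 E₀ := Submodule.finiteDimensional_inf_left _ _
  let ι : E₀ →L[𝕜] E :=
    (Submodule.inclusion (inf_le_left : E₀ ≤ E)).mkContinuous 1 fun x => by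
      simp [Submodule.coe_norm]
  obtain ⟨T₀, hT₀, hn₀⟩ := hC E₀ (inf_le_inf_right _ hEZ) hE₀ (t.comp ι)
  have hι : ‖ι‖ ≤ 1 := LinearMap.mkContinuous_norm_le _ zero_le_one _
  have hn₀' : ‖T₀‖ ≤ C * ‖t‖ := by
    refine hn₀.trans ?_
    gcongr
    calc ‖t.comp ι‖ ≤ ‖t‖ * ‖ι‖ := ContinuousLinearMap.opNorm_comp_le _ _
      _ ≤ ‖t‖ * 1 := by gcongr
      _ = ‖t‖ := mul_one _
  set d : E →L[𝕜] X := t - T₀.comp E.subtypeL with hd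
  have hdn : ‖d‖ ≤ (1 + C) * ‖t‖ := by
    calc ‖d‖ ≤ ‖t‖ + ‖T₀.comp E.subtypeL‖ := norm_sub_le _ _
      _ ≤ ‖t‖ + ‖T₀‖ * ‖E.subtypeL‖ := by
        gcongr; exact ContinuousLinearMap.opNorm_comp_le _ _
      _ ≤ ‖t‖ + ‖T₀‖ * 1 := by
        gcongr; exact E.norm_subtypeL_le
      _ ≤ (1 + C) * ‖t‖ := by linarith
  have hd0 : ∀ e : E, φ e = 0 → d e = 0 := fun e he => by
    have := hT₀ ⟨e, e.2, he⟩
    simp only [hd, sub_apply, ContinuousLinearMap.comp_apply,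
      Submodule.subtypeL_apply, sub_eq_zero]
    exact this.symm
  by_cases hφ : ∃ e₀ : E, φ e₀ ≠ 0
  · obtain ⟨e₀, he₀⟩ := hφ
    set ψ : StrongDual 𝕜 E := φ.comp E.subtypeL
    obtain ⟨ψ', hψ', hψn⟩ := exists_extension_norm_eq E ψ
    set x : X := (φ e₀)⁻¹ • d e₀
    have hdx : d = ψ.smulRight x := by
      ext e
      have h1 : d (e - (φ e * (φ e₀)⁻¹) • e₀) = 0 := hd0 _ (by simp [he₀])
      rw [map_sub, map_smul, sub_eq_zero] at h1
      rw [h1]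
      simp [ψ, x, mul_smul]
    refine ⟨T₀ + ψ'.smulRight x, fun e => ?_, ?_⟩
    · have h2 : d e = ψ e • x := by rw [hdx]; rfl
      have h3 : d e = t e - T₀ e := rfl
      rw [add_apply, ContinuousLinearMap.smulRight_apply, hψ' e, ← h2, h3]
      abel
    · have h4 : ‖ψ'.smulRight x‖ = ‖d‖ := by
        rw [hdx, ContinuousLinearMap.norm_smulRight_apply, ContinuousLinearMap.norm_smulRight_apply,
          hψn]
      calc ‖T₀ + ψ'.smulRight x‖ ≤ ‖T₀‖ + ‖ψ'.smulRight x‖ := norm_add_le _ _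
        _ ≤ C * ‖t‖ + (1 + C) * ‖t‖ := by rw [h4]; gcongr
        _ = _ := by ring
  · push Not at hφ
    refine ⟨T₀, fun e => ?_, hn₀'.trans ?_⟩
    · have h3 : d e = t e - T₀ e := rfl
      rw [hd0 e (hφ e), eq_comm, sub_eq_zero] at h3
      exact h3.symm
    · gcongr; linarith

theorem HasFiniteExtensions.of_inf_iInf_ker {Z : Submodule 𝕜 X} (Φ : Finset (StrongDual 𝕜 X))
    (h : HasFiniteExtensions (Z ⊓ ⨅ φ ∈ Φ, LinearMap.ker (φ : X →ₗ[𝕜] 𝕜))) :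
    HasFiniteExtensions Z := by
  classical
  induction Φ using Finset.induction_on with
  | empty => simpa using h
  | insert φ Φ _ ih =>
    refine ih (.of_inf_ker φ ?_)
    rwa [Finset.iInf_insert, inf_comm (LinearMap.ker _), ← inf_assoc] at h

/-- Take norming functionals at a finite `1/2`-net of the unit sphere of `F`: at each unit vector of
`F` one of them is at least `1/2` in modulus, and they do not see `z`. -/
theorem exists_finite_norming (F : Submodule 𝕜 X) [FiniteDimensional 𝕜 F] :
    ∃ Φ : Finset (StrongDual 𝕜 X), ∀ y ∈ F, ∀ z ∈ ⨅ φ ∈ Φ, LinearMap.ker (φ : X →ₗ[𝕜] 𝕜),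
      ‖y‖ ≤ 2 * ‖y + z‖ := by
  classical
  have : ProperSpace F := FiniteDimensional.proper_rclike 𝕜 F
  obtain ⟨s, hss, hsf, hs⟩ := (isCompact_sphere (0 : F) 1).finite_cover_balls
    (e := 1 / 2) (by norm_num)
  choose g hg hgx using fun x : X => exists_dual_vector'' 𝕜 x
  refine ⟨hsf.toFinset.image fun x => g x, fun y hy z hz => ?_⟩
  rcases eq_or_ne y 0 with rfl | hy0
  · simp
  have hyn : 0 < ‖y‖ := norm_pos_iff.2 hy0
  set y' : F := ((‖y‖ : 𝕜)⁻¹) • ⟨y, hy⟩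
  have hy' : y' ∈ Metric.sphere (0 : F) 1 := by
    simp [y', norm_smul, hyn.ne']
  obtain ⟨x, hx, hxy⟩ := Set.mem_iUnion₂.1 (hs hy')
  have hx1 : ‖(x : X)‖ = 1 := by simpa using hss hx
  have h2 : ‖(y' : X) - x‖ < 1 / 2 := by
    have : ‖y' - x‖ < 1 / 2 := by simpa [dist_eq_norm] using hxy
    simpa only [Submodule.coe_norm, Submodule.coe_sub] using this
  have hle : ∀ v : X, ‖g x v‖ ≤ ‖v‖ := fun v =>
    ((g x).le_opNorm v).trans (mul_le_of_le_one_left (norm_nonneg _) (hg _))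
  have h3 : 1 / 2 ≤ ‖g x (y' : X)‖ := by
    have h4 : ‖g x (x : X)‖ = 1 := by rw [hgx, hx1]; simp
    have h5 := hle ((y' : X) - x)
    rw [map_sub] at h5
    have h6 := norm_sub_norm_le (g x (x : X)) (g x (y' : X))
    rw [norm_sub_rev] at h6
    linarith
  have h7 : ‖g x (y' : X)‖ = ‖y‖⁻¹ * ‖g x y‖ := by simp [y']
  have hz0 : g x z = 0 := by
    have := (Submodule.mem_iInf _).1 ((Submodule.mem_iInf _).1 hz (g x))
      (by simpa using ⟨(x : X), ⟨x.2, hx⟩, rfl⟩)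
    simpa using this
  have h8 := hle (y + z)
  rw [map_add, hz0, add_zero] at h8
  rw [h7, ← div_eq_inv_mul, le_div_iff₀ hyn] at h3
  linarith

/-! ### Construction of the subspace `Y` -/

theorem exists_small_of_not_hasFiniteExtensions {Z : Submodule 𝕜 X} (hZ : ¬ HasFiniteExtensions Z)
    (n : ℕ) : ∃ E : Submodule 𝕜 X, E ≤ Z ∧ FiniteDimensional 𝕜 E ∧ ∃ t : E →L[𝕜] X,
      ‖t‖ ≤ 1 / 6 ∧ ∀ T : X →L[𝕜] X, (∀ e : E, T (e : X) = t e) → (n : ℝ) < ‖T‖ := by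
  by_contra hcon
  push Not at hcon
  refine hZ ⟨6 * n, by positivity, fun E hE hfd t => ?_⟩
  rcases eq_or_ne t 0 with rfl | ht
  · exact ⟨0, by simp, by simp⟩
  have htn : 0 < ‖t‖ := norm_pos_iff.2 ht
  set c : ℝ := 6 * ‖t‖
  have hc : 0 < c := by positivity
  obtain ⟨T, hT, hTn⟩ := hcon E hE hfd (((c : 𝕜)⁻¹) • t) (by
    rw [norm_smul, norm_inv, RCLike.norm_ofReal, abs_of_pos hc]
    simp only [c]; field_simp; exact le_rfl)
  have hc' : (c : 𝕜) ≠ 0 := by exact_mod_cast hc.ne'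
  refine ⟨(c : 𝕜) • T, fun e => ?_, ?_⟩
  · simp [hT, hc']
  · rw [norm_smul, RCLike.norm_ofReal, abs_of_pos hc]
    calc c * ‖T‖ ≤ c * n := by gcongr
      _ = 6 * n * ‖t‖ := by simp only [c]; ring

/-- Stages of the construction of a finite dimensional decomposition: a finite dimensional `G`, and a
large closed `Z` on which the projection of `G ⊔ Z` onto `G` along `Z` has norm at most `2`. -/
structure DecompositionStage (𝕜 X : Type*) [RCLike 𝕜] [NormedAddCommGroup X] [NormedSpace 𝕜 X] where
  G : Submodule 𝕜 X
  Z : Submodule 𝕜 X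
  finite : FiniteDimensional 𝕜 G
  closed : IsClosed (Z : Set X)
  large : ¬ HasFiniteExtensions Z
  norm_le : ∀ y ∈ G, ∀ z ∈ Z, ‖y‖ ≤ 2 * ‖y + z‖

theorem DecompositionStage.exists_next (q : DecompositionStage 𝕜 X) (n : ℕ) :
    ∃ (q' : DecompositionStage 𝕜 X) (E : Submodule 𝕜 X) (t : E →L[𝕜] X),
      FiniteDimensional 𝕜 E ∧ E ≤ q.Z ∧ q'.G = q.G ⊔ E ∧ q'.Z ≤ q.Z ∧ ‖t‖ ≤ 1 / 6 ∧
      ∀ T : X →L[𝕜] X, (∀ e : E, T (e : X) = t e) → (n : ℝ) < ‖T‖ := by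
  obtain ⟨E, hE, hfd, t, ht, hT⟩ := exists_small_of_not_hasFiniteExtensions q.large n
  have := q.finite
  obtain ⟨Φ, hΦ⟩ := exists_finite_norming (q.G ⊔ E)
  refine ⟨⟨q.G ⊔ E, q.Z ⊓ ⨅ φ ∈ Φ, LinearMap.ker (φ : X →ₗ[𝕜] 𝕜), inferInstance, ?_,
    fun h => q.large h.of_inf_iInf_ker, fun y hy z hz => hΦ y hy z hz.2⟩, E, t, hfd, hE, rfl,
    inf_le_left, ht, hT⟩
  simp only [Submodule.coe_inf, Submodule.coe_iInf]
  exact q.closed.inter (isClosed_iInter fun φ => isClosed_iInter fun _ => φ.isClosed_ker)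

/-- An operator on the new block `E` of a decomposition extends, with controlled norm, by zero on the
previous and the later blocks. -/
theorem DecompositionStage.exists_block_operator (q q' : DecompositionStage 𝕜 X)
    {E : Submodule 𝕜 X} (t : E →L[𝕜] X) (hE : E ≤ q.Z) (hG : q'.G = q.G ⊔ E)
    (ht : ‖t‖ ≤ 1 / 6) : ∃ s : X →ₗ[𝕜] X, (∀ e : E, s e = t e) ∧
      LinearMap.range s ≤ LinearMap.range (t : E →ₗ[𝕜] X) ∧ ∀ v ∈ q'.G ⊔ q'.Z, ‖s v‖ ≤ ‖v‖ := by
  -- Disjointness allows an algebraic projection onto `E` that kills both `q.G` and `q'.Z`; its norm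
  -- is controlled only on `q'.G ⊔ q'.Z`.
  have hdis : Disjoint (q.G ⊔ q'.Z) E := by
    rw [Submodule.disjoint_def]
    intro e he heE
    obtain ⟨y, hy, z, hz, rfl⟩ := Submodule.mem_sup.1 he
    have h1 := q'.norm_le (y + z - y) (by
      rw [hG]; exact sub_mem (Submodule.mem_sup_right heE) (Submodule.mem_sup_left hy)) (-z)
      (neg_mem hz)
    have hz0 : z = 0 := by simpa using h1
    have h2 := q.norm_le y hy (-y) (neg_mem (by simpa [hz0] using hE heE))
    have hy0 : y = 0 := by simpa using h2
    simp [hz0, hy0]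
  obtain ⟨K, hK, hc⟩ := hdis.exists_isCompl
  refine ⟨(t : E →ₗ[𝕜] X) ∘ₗ E.projectionOnto K hc.symm, fun e => by simp, ?_, ?_⟩
  · exact LinearMap.range_comp_le_range _ _
  intro v hv
  obtain ⟨w, hw, z, hz, rfl⟩ := Submodule.mem_sup.1 hv
  rw [hG] at hw
  obtain ⟨y, hy, e, he, rfl⟩ := Submodule.mem_sup.1 hw
  have hp : E.projectionOnto K hc.symm (y + e + z) = ⟨e, he⟩ := by
    have h1 : E.projectionOnto K hc.symm y = 0 := by
      simpa using hK (Submodule.mem_sup_left hy)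
    have h2 : E.projectionOnto K hc.symm z = 0 := by
      simpa using hK (Submodule.mem_sup_right hz)
    rw [map_add, map_add, h1, h2, zero_add, add_zero]
    exact Submodule.projectionOnto_apply_left hc.symm ⟨e, he⟩
  have h1 := q'.norm_le (y + e) (by rw [hG]; exact hw) z hz
  have h2 := q.norm_le y hy e (hE he)
  -- The factor `6 = (1 + 2) * 2` removes `y`, then `z`; it is the reason for `‖t‖ ≤ 1 / 6`.
  have h3 : ‖e‖ ≤ 6 * ‖y + e + z‖ := by
    have h4 := norm_sub_le (y + e) y
    rw [add_sub_cancel_left] at h4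
    linarith
  calc ‖((t : E →ₗ[𝕜] X) ∘ₗ E.projectionOnto K hc.symm) (y + e + z)‖ = ‖t ⟨e, he⟩‖ := by
        rw [LinearMap.comp_apply, hp]; rfl
    _ ≤ ‖t‖ * ‖e‖ := t.le_opNorm _
    _ ≤ 1 / 6 * (6 * ‖y + e + z‖) := by gcongr
    _ = ‖y + e + z‖ := by ring

theorem exists_subspace_of_not_isUFO (hX : ¬ IsUFO 𝕜 X) :
    ∃ (Y : Submodule 𝕜 X) (s : ℕ → Y →L[𝕜] X), IsClosed (Y : Set X) ∧ ¬ FiniteDimensional 𝕜 Y ∧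
      ∀ n, ‖s n‖ ≤ 1 ∧ (∃ S : X →L[𝕜] X, ∀ y : Y, S y = s n y) ∧
        ∀ T : X →L[𝕜] X, (∀ y : Y, T y = s n y) → (n : ℝ) < ‖T‖ := by
  let q₀ : DecompositionStage 𝕜 X :=
    { G := ⊥, Z := ⊤, finite := inferInstance, closed := isClosed_univ,
      large := fun h => hX h.isUFO, norm_le := fun y hy z _ => by
        rw [(Submodule.mem_bot 𝕜).1 hy]; simp }
  choose next E t hfd hE hG hZ ht hT using
    fun (q : DecompositionStage 𝕜 X) (n : ℕ) => q.exists_next n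
  let q : ℕ → DecompositionStage 𝕜 X := fun n => Nat.rec q₀ (fun n q => next q n) n
  have hq : ∀ n, q (n + 1) = next (q n) n := fun n => rfl
  have hGs : ∀ n, (q (n + 1)).G = (q n).G ⊔ E (q n) n := fun n => hG (q n) n
  have hGm : Monotone fun n => (q n).G := monotone_nat_of_le_succ fun n => by
    rw [hGs]; exact le_sup_left
  have hZm : Antitone fun n => (q n).Z := antitone_nat_of_succ_le fun n => hZ (q n) n
  have hGZ : ∀ n k, (q k).G ≤ (q n).G ⊔ (q n).Z := by
    intro n k
    rcases le_total k n with h | h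
    · exact (hGm h).trans le_sup_left
    · induction k, h using Nat.le_induction with
      | base => exact le_sup_left
      | succ k hk ih =>
        rw [hGs]
        exact sup_le ih (((hE (q k) k).trans (hZm hk)).trans le_sup_right)
  set Y : Submodule 𝕜 X := (⨆ k, (q k).G).topologicalClosure
  -- A closed subspace plus a finite dimensional one is closed, so the block estimates hold on the
  -- whole closure `Y`.
  have hYV : ∀ n, Y ≤ (q n).G ⊔ (q n).Z := fun n => by
    have := (q n).finite
    refine Submodule.topologicalClosure_minimal _ (iSup_le (hGZ n)) ?_
    rw [sup_comm]
    exact Submodule.isClosed_sup_finiteDimensional _ _ (q n).closed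
  have hEY : ∀ n, E (q n) n ≤ Y := fun n => by
    refine le_trans ?_ (Submodule.le_topologicalClosure _)
    refine le_trans ?_ (le_iSup _ (n + 1))
    rw [hGs]; exact le_sup_right
  choose σ hσ hσr hσn using fun n =>
    (q n).exists_block_operator (q (n + 1)) (t (q n) n) (hE (q n) n) (hGs n) (ht (q n) n)
  let s : ℕ → Y →L[𝕜] X := fun n =>
    (σ n ∘ₗ Y.subtype).mkContinuous 1 fun y => by
      simpa using hσn n y (hYV (n + 1) y.2)
  have hs : ∀ n (y : Y), s n y = σ n y := fun n y => rfl
  have hsn : ∀ n, ‖s n‖ ≤ 1 := fun n => LinearMap.mkContinuous_norm_le _ zero_le_one _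
  have hsT : ∀ n (T : X →L[𝕜] X), (∀ y : Y, T y = s n y) → (n : ℝ) < ‖T‖ := fun n T h =>
    hT (q n) n T fun e => by
      rw [← hσ n e]; exact h ⟨e, hEY n e.2⟩
  refine ⟨Y, s, Submodule.isClosed_topologicalClosure _, fun hY => ?_, fun n =>
    ⟨hsn n, ?_, hsT n⟩⟩
  -- Were `Y` finite dimensional, a bounded projection `P` onto it would extend every `s n` with
  -- norm at most `‖P‖`.
  · obtain ⟨P, hP⟩ := Submodule.ClosedComplemented.of_finiteDimensional Y
    obtain ⟨n, hn⟩ := exists_nat_gt ‖P‖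
    refine lt_irrefl (n : ℝ) ((hsT n ((s n).comp P) fun y => by simp [hP]).trans
      (lt_of_le_of_lt ?_ hn))
    calc ‖(s n).comp P‖ ≤ ‖s n‖ * ‖P‖ := ContinuousLinearMap.opNorm_comp_le _ _
      _ ≤ ‖P‖ := mul_le_of_le_one_left (norm_nonneg _) (hsn n)
  · have := hfd (q n) n
    have : FiniteDimensional 𝕜 (LinearMap.range (s n : Y →ₗ[𝕜] X)) := by
      refine Submodule.finiteDimensional_of_le
        (S₂ := LinearMap.range ((t (q n) n : E (q n) n →L[𝕜] X) : E (q n) n →ₗ[𝕜] X)) ?_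
      rintro _ ⟨y, rfl⟩
      exact hσr n ⟨y, rfl⟩
    obtain ⟨S, hS⟩ := ContinuousLinearMap.exist_extension_of_finiteDimensional_range (s n)
    exact ⟨S, fun y => by rw [hS]; rfl⟩

end FiniteExtension

/-! ### Sequence spaces and coding operators -/

section SequenceSpaces

/-- A normed space `V` of sequences in `Y`, with finitely supported sequences dense. -/
structure SeqModel (𝕜 Y V : Type*) [RCLike 𝕜] [NormedAddCommGroup Y] [NormedSpace 𝕜 Y]
    [NormedAddCommGroup V] [NormedSpace 𝕜 V] where
  coord : ℕ → V →L[𝕜] Y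
  single : ℕ → Y →L[𝕜] V
  norm_coord_le : ∀ i, ‖coord i‖ ≤ 1
  norm_single_le : ∀ i, ‖single i‖ ≤ 1
  coord_single_same : ∀ i y, coord i (single i y) = y
  coord_single_ne : ∀ i j y, i ≠ j → coord i (single j y) = 0
  ext : ∀ v w, (∀ i, coord i v = coord i w) → v = w
  hasSum_single : ∀ v, HasSum (fun i => single i (coord i v)) v

variable {𝕜 : Type*} [RCLike 𝕜]
  {Y V : Type*} [NormedAddCommGroup Y] [NormedSpace 𝕜 Y] [NormedAddCommGroup V] [NormedSpace 𝕜 V]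
  {X W : Type*} [NormedAddCommGroup X] [NormedSpace 𝕜 X] [NormedAddCommGroup W] [NormedSpace 𝕜 W]

/-- Sequences dominated coordinatewise in norm by a rearrangement of an element of `V` belong to `W`,
with norm control. -/
def SeqModel.Dominates (M : SeqModel 𝕜 Y V) (N : SeqModel 𝕜 X W) : Prop :=
  ∀ (v : V) (b : ℕ → X) (σ : ℕ → ℕ), Set.InjOn σ {i | b i ≠ 0} →
    (∀ i, ‖b i‖ ≤ ‖M.coord (σ i) v‖) → ∃ w : W, (∀ i, N.coord i w = b i) ∧ ‖w‖ ≤ ‖v‖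

theorem SeqModel.Dominates.exists_clm {M : SeqModel 𝕜 Y V} {N : SeqModel 𝕜 X W}
    (h : M.Dominates N) (σ : ℕ → ℕ) (u : ℕ → Y →L[𝕜] X) {C : ℝ} (hC : 0 < C)
    (hu : ∀ i, ‖u i‖ ≤ C) (hσ : Set.InjOn σ {i | u i ≠ 0}) :
    ∃ T : V →L[𝕜] W, (∀ v i, N.coord i (T v) = u i (M.coord (σ i) v)) ∧ ‖T‖ ≤ C := by
  have hCn : ‖(C : 𝕜)‖ = C := by rw [RCLike.norm_ofReal, abs_of_pos hC]
  have key : ∀ v : V, ∃ w : W, (∀ i, N.coord i w = u i (M.coord (σ i) v)) ∧ ‖w‖ ≤ C * ‖v‖ := by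
    intro v
    obtain ⟨w, hw, hwn⟩ := h ((C : 𝕜) • v) (fun i => u i (M.coord (σ i) v)) σ
      (hσ.mono (by intro i hi h0; exact hi (by simp [h0]))) fun i => by
        rw [map_smul, norm_smul, hCn]
        exact (u i).le_of_opNorm_le (hu i) _
    exact ⟨w, hw, by rwa [norm_smul, hCn] at hwn⟩
  choose f hf hfn using key
  refine ⟨LinearMap.mkContinuous ⟨⟨f, fun v w => ?_⟩, fun c v => ?_⟩ C hfn, hf,
    LinearMap.mkContinuous_norm_le _ hC.le _⟩
  · exact N.ext _ _ fun i => by simp [hf]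
  · exact N.ext _ _ fun i => by simp [hf]

/-- A countable family of Borel sets of reals separating points, as a coding of real sequences by
binary sequences; the `i`-th digit belongs to the `(Nat.unpair i).1`-th real. -/
noncomputable def digit (x : ℕ → ℝ) (i : ℕ) : Bool :=
  decide ((((Denumerable.eqv ℚ).symm i.unpair.2 : ℚ) : ℝ) < x i.unpair.1)

theorem measurable_digit : Measurable digit := by
  refine measurable_pi_lambda _ fun i => ?_
  refine measurable_to_bool ?_
  have : MeasurableSet {x : ℕ → ℝ |
      (((Denumerable.eqv ℚ).symm i.unpair.2 : ℚ) : ℝ) < x i.unpair.1} :=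
    measurableSet_lt measurable_const (measurable_pi_apply _)
  convert this using 1
  ext x
  simp [digit]

theorem eq_of_digit_eq {x y : ℕ → ℝ} {n : ℕ}
    (h : ∀ i : ℕ, i.unpair.1 = n → digit x i = digit y i) : x n = y n := by
  refine eq_of_forall_rat_lt_iff_lt fun c => ?_
  have := h (Nat.pair n (Denumerable.eqv ℚ c)) (by simp)
  simpa [digit] using this

theorem digit_eq_of_eq {x y : ℕ → ℝ} {i : ℕ} (h : x i.unpair.1 = y i.unpair.1) :
    digit x i = digit y i := by
  simp [digit, h]

/-- Even places keep a copy of the input, which bounds the operator below; odd places carry the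
digits. The index map `i / 2` is injective only on each parity class, hence the sum of two operators
and the bound 2. -/
theorem exists_codingOperator {M : SeqModel 𝕜 Y V} {N : SeqModel 𝕜 X W} (h : M.Dominates N)
    {ι : Y →L[𝕜] X} (hι : ‖ι‖ ≤ 1) {s : ℕ → Y →L[𝕜] X} (hs : ∀ i, ‖s i‖ ≤ 1) (α : ℕ → Bool) :
    ∃ T : V →L[𝕜] W, ‖T‖ ≤ 2 ∧
      (∀ v j, N.coord (2 * j) (T v) = ι (M.coord j v)) ∧
      ∀ v j, N.coord (2 * j + 1) (T v) = if α j then s j (M.coord j v) else 0 := by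
  obtain ⟨T₀, hT₀, hn₀⟩ := h.exists_clm (fun i => i / 2)
    (fun i => if i % 2 = 0 then ι else 0) one_pos
    (fun i => by split_ifs <;> simp [hι])
    (fun i hi j hj hij => by
      simp only [Set.mem_ofPred_eq, ne_eq, ite_eq_right_iff, Classical.not_imp] at hi hj hij
      omega)
  obtain ⟨T₁, hT₁, hn₁⟩ := h.exists_clm (fun i => i / 2)
    (fun i => if i % 2 = 1 then (if α (i / 2) then s (i / 2) else 0) else 0) one_pos
    (fun i => by split_ifs <;> simp [hs])
    (fun i hi j hj hij => by
      simp only [Set.mem_ofPred_eq, ne_eq, ite_eq_right_iff, Classical.not_imp] at hi hj hij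
      omega)
  refine ⟨T₀ + T₁, (norm_add_le _ _).trans (by linarith), fun v j => ?_, fun v j => ?_⟩
  · have h1 : 2 * j / 2 = j := by omega
    simp [hT₀, hT₁, h1]
  · have h1 : (2 * j + 1) / 2 = j := by omega
    have h2 : (2 * j + 1) % 2 = 1 := by omega
    simp only [add_apply, map_add, hT₀, hT₁, h1, h2]
    split_ifs <;> simp_all

theorem SeqModel.ext_even_odd (N : SeqModel 𝕜 X W) {v w : W}
    (h₀ : ∀ j, N.coord (2 * j) v = N.coord (2 * j) w)
    (h₁ : ∀ j, N.coord (2 * j + 1) v = N.coord (2 * j + 1) w) : v = w :=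
  N.ext _ _ fun i => by
    obtain ⟨j, rfl | rfl⟩ := Nat.even_or_odd' i
    · exact h₀ j
    · exact h₁ j

/-- Uniformly bounded operators `S j` induce an automorphism adding `S j` of the coordinate `2 * j` to
the coordinate `2 * j + 1`. -/
theorem exists_shear {N : SeqModel 𝕜 X W} (h : N.Dominates N) (S : ℕ → X →L[𝕜] X)
    {C : ℝ} (hC : 0 < C) (hS : ∀ j, ‖S j‖ ≤ C) :
    ∃ A : W ≃L[𝕜] W, ∀ w j, N.coord (2 * j) (A w) = N.coord (2 * j) w ∧
      N.coord (2 * j + 1) (A w) = N.coord (2 * j + 1) w + S j (N.coord (2 * j) w) := by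
  -- The truncation of `i - 1` at `i = 0` is harmless, since only odd `i` carry a nonzero operator.
  obtain ⟨D, hD, -⟩ := h.exists_clm (fun i => i - 1)
    (fun i => if i % 2 = 1 then S (i / 2) else 0) hC
    (fun i => by split_ifs <;> simp [hS, hC.le])
    (fun i hi j hj hij => by
      simp only [Set.mem_ofPred_eq, ne_eq, ite_eq_right_iff, Classical.not_imp] at hi hj hij
      omega)
  have h0 : ∀ w j, N.coord (2 * j) (D w) = 0 := fun w j => by simp [hD]
  have h1 : ∀ w j, N.coord (2 * j + 1) (D w) = S j (N.coord (2 * j) w) := fun w j => by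
    have h1 : (2 * j + 1) / 2 = j := by omega
    have h2 : (2 * j + 1) % 2 = 1 := by omega
    simp [hD, h1, h2]
  -- `D` reads even places and writes odd ones, so it squares to zero and `id - D` inverts `id + D`.
  have hDD : ∀ w, D (D w) = 0 := fun w => N.ext_even_odd
    (fun j => by simp [h0]) (fun j => by simp [h1, h0])
  refine ⟨ContinuousLinearEquiv.equivOfInverse (ContinuousLinearMap.id 𝕜 W + D)
    (ContinuousLinearMap.id 𝕜 W - D) (fun w => by simp [hDD]) (fun w => by simp [hDD]),
    fun w j => ⟨?_, ?_⟩⟩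
  · simp [h0]
  · simp [h1]

theorem norm_le_of_coord_even {M : SeqModel 𝕜 Y V} {N : SeqModel 𝕜 X W} (h : N.Dominates M)
    {v : V} {w : W} (hvw : ∀ j, ‖M.coord j v‖ ≤ ‖N.coord (2 * j) w‖) : ‖v‖ ≤ ‖w‖ := by
  obtain ⟨v', hv', hn⟩ := h w (fun j => M.coord j v) (fun j => 2 * j)
    (fun i _ j _ hij => by simpa using hij) hvw
  rwa [M.ext v' v hv'] at hn

theorem isEmbedding_of_norm_le (T : V →L[𝕜] W) (h : ∀ v, ‖v‖ ≤ ‖T v‖) :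
    Topology.IsEmbedding (fun v => T v) :=
  (T.antilipschitz_of_bound (K := 1) (by simpa using h)).isUniformEmbedding
    T.uniformContinuous |>.isEmbedding

/-- The copy of `X` at place 1 has zero even coordinates, so it meets the range trivially and embeds
in the quotient. -/
theorem infinite_codim {N : SeqModel 𝕜 X W} (hX : ¬ FiniteDimensional 𝕜 X)
    (T : V →ₗ[𝕜] W) (hT : ∀ v, (∀ j, N.coord (2 * j) (T v) = 0) → T v = 0) :
    ¬ FiniteDimensional 𝕜 (W ⧸ LinearMap.range T) := by
  intro hfd
  refine hX (FiniteDimensional.of_injective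
    ((LinearMap.range T).mkQ ∘ₗ (N.single 1 : X →ₗ[𝕜] W)) ?_)
  rw [← LinearMap.ker_eq_bot, LinearMap.ker_eq_bot']
  intro x hx
  simp only [LinearMap.comp_apply, Submodule.mkQ_apply, Submodule.Quotient.mk_eq_zero] at hx
  obtain ⟨v, hv⟩ := hx
  have h0 : N.single 1 x = 0 := by
    rw [ContinuousLinearMap.coe_coe] at hv
    rw [← hv]
    exact hT v fun j => by rw [hv]; exact N.coord_single_ne _ _ _ (by omega)
  rw [← N.coord_single_same 1 x, h0, map_zero]


/-- On a vector supported at `j` the value depends on the single digit `α j`; the uniform bound 2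
carries continuity over to limits of finite sums. -/
theorem continuous_of_digits {M : SeqModel 𝕜 Y V} {N : SeqModel 𝕜 X W}
    {ι : Y →L[𝕜] X} {s : ℕ → Y →L[𝕜] X} (T : (ℕ → Bool) → V →L[𝕜] W) (hT : ∀ α, ‖T α‖ ≤ 2)
    (h₀ : ∀ α v j, N.coord (2 * j) (T α v) = ι (M.coord j v))
    (h₁ : ∀ α v j, N.coord (2 * j + 1) (T α v) = if α j then s j (M.coord j v) else 0) (v : V) :
    Continuous fun α => T α v := by
  have hs : ∀ j y, Continuous fun α => T α (M.single j y) := by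
    intro j y
    have : (fun α => T α (M.single j y)) =
        fun α => (fun b : Bool => T (fun _ => b) (M.single j y)) (α j) := by
      funext α
      refine N.ext_even_odd (fun i => by rw [h₀, h₀]) fun i => ?_
      rw [h₁, h₁]
      rcases eq_or_ne i j with rfl | hij
      · rfl
      · simp [M.coord_single_ne i j y hij]
    rw [this]
    have hc : Continuous fun b : Bool => T (fun _ => b) (M.single j y) :=
      continuous_of_discreteTopology
    exact hc.comp (continuous_apply (A := fun _ : ℕ => Bool) j)
  refine (TendstoUniformly.continuous (p := Filter.atTop)
    (F := fun (F : Finset ℕ) α => T α (∑ i ∈ F, M.single i (M.coord i v))) ?_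
    (Filter.Eventually.frequently (Filter.Eventually.of_forall fun F => ?_)))
  · rw [Metric.tendstoUniformly_iff]
    intro ε hε
    have := Metric.tendsto_nhds.1 (M.hasSum_single v) (ε / 2) (by positivity)
    filter_upwards [this] with F hF α
    rw [dist_eq_norm] at hF
    rw [dist_comm, dist_eq_norm, ← map_sub]
    calc _ ≤ 2 * _ := (T α).le_of_opNorm_le (hT α) _
      _ < ε := by linarith
  · simp only [map_sum]
    exact continuous_finsetSum _ fun i _ => hs _ _

/-- Since `α j` is false, `T α` maps `M.single j y` to `ι y` at place `2 * j` alone. The corner of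
`B` from place `2 * j` to `2 * j + 1` therefore extends `s j`, with norm at most `‖B‖`. -/
theorem lt_norm_of_digits {M : SeqModel 𝕜 Y V} {N : SeqModel 𝕜 X W}
    {ι : Y →L[𝕜] X} {s : ℕ → Y →L[𝕜] X} (T : (ℕ → Bool) → V →L[𝕜] W)
    (h₀ : ∀ α v j, N.coord (2 * j) (T α v) = ι (M.coord j v))
    (h₁ : ∀ α v j, N.coord (2 * j + 1) (T α v) = if α j then s j (M.coord j v) else 0)
    {α β : ℕ → Bool} (B : W →L[𝕜] W) (hB : ∀ v, B (T α v) = T β v) {j : ℕ}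
    (hα : α j = false) (hβ : β j = true) {c : ℝ}
    (hc : ∀ R : X →L[𝕜] X, (∀ y, R (ι y) = s j y) → c < ‖R‖) : c < ‖B‖ := by
  have hR : ∀ y, ((N.coord (2 * j + 1)).comp (B.comp (N.single (2 * j)))) (ι y) = s j y := by
    intro y
    have h2 : N.single (2 * j) (ι y) = T α (M.single j y) := by
      refine N.ext_even_odd (fun i => ?_) fun i => ?_
      · rw [h₀]
        rcases eq_or_ne i j with rfl | hij
        · rw [N.coord_single_same, M.coord_single_same]
        · rw [N.coord_single_ne _ _ _ (by omega), M.coord_single_ne _ _ _ hij, map_zero]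
      · rw [h₁, N.coord_single_ne _ _ _ (by omega)]
        rcases eq_or_ne i j with rfl | hij
        · simp [hα]
        · simp [M.coord_single_ne _ _ _ hij]
    rw [ContinuousLinearMap.comp_apply, ContinuousLinearMap.comp_apply, h2, hB, h₁, hβ, if_pos rfl,
      M.coord_single_same]
  refine (hc _ hR).trans_le ?_
  calc _ ≤ ‖N.coord (2 * j + 1)‖ * (‖B‖ * ‖N.single (2 * j)‖) :=
        (ContinuousLinearMap.opNorm_comp_le _ _).trans (by
          gcongr; exact ContinuousLinearMap.opNorm_comp_le _ _)
    _ ≤ 1 * (‖B‖ * 1) := by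
        gcongr
        · exact N.norm_coord_le _
        · exact N.norm_single_le _
    _ = ‖B‖ := by ring

/-! ### The reduction of `E₁` -/

theorem borelReducible_E₁_positionSetoid (M : SeqModel 𝕜 Y V) (N : SeqModel 𝕜 X W)
    (hMN : M.Dominates N) (hNM : N.Dominates M) (hNN : N.Dominates N)
    (hX : ¬ FiniteDimensional 𝕜 X) (ι : Y →ₗᵢ[𝕜] X) (s : ℕ → Y →L[𝕜] X) (hs : ∀ n, ‖s n‖ ≤ 1)
    (hS : ∀ n, ∃ S : X →L[𝕜] X, ∀ y, S (ι y) = s n y)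
    (hR : ∀ n, ∀ R : X →L[𝕜] X, (∀ y, R (ι y) = s n y) → (n : ℝ) < ‖R‖) :
    BorelReducible E₁ (positionSetoid 𝕜 V W) := by
  choose S hS using hS
  choose T hTn h₀ h₁ using exists_codingOperator (M := M) (N := N) hMN
    ι.norm_toContinuousLinearMap_le (s := fun j => s j.unpair.1) (fun j => hs _)
  have hle : ∀ α v, ‖v‖ ≤ ‖T α v‖ := fun α v =>
    norm_le_of_coord_even hNM fun j => by rw [h₀]; exact (ι.norm_map _).ge
  have hemb : ∀ α, ((T α : V →L[𝕜] W) : V →Lₚₜ[𝕜] W) ∈ Emb 𝕜 V W := fun α => by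
    refine ⟨isEmbedding_of_norm_le (T α) (hle α),
      infinite_codim (N := N) hX (T α : V →ₗ[𝕜] W) fun v hv => ?_⟩
    have : v = 0 := M.ext _ _ fun j => by
      have := hv j
      rw [ContinuousLinearMap.coe_coe, h₀] at this
      rw [map_zero]
      exact ι.injective (by simpa using this)
    rw [this, map_zero]
  let F : (ℕ → Bool) → Emb 𝕜 V W := fun α => ⟨T α, hemb α⟩
  have hF : Continuous F := Continuous.subtype_mk
    (PointwiseConvergenceCLM.continuous_of_continuous_eval
      (continuous_of_digits (N := N) T hTn h₀ h₁)) _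
  refine ⟨fun x => F (digit x), hF.measurable.comp measurable_digit, fun x y => ⟨?_, ?_⟩⟩
  · rintro ⟨n, hn⟩
    -- The shear adds or removes the odd entry where digits differ. Only `S m` with `m < n` occur,
    -- whence the uniform bound.
    obtain ⟨A, hA⟩ := exists_shear hNN (fun j => if digit x j = digit y j then 0 else
        if digit x j then S j.unpair.1 else -S j.unpair.1)
      (C := 1 + ∑ m ∈ Finset.range n, ‖S m‖) (by positivity) fun j => by
        have h0 : 0 ≤ ∑ m ∈ Finset.range n, ‖S m‖ := by positivity
        by_cases hd : digit x j = digit y j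
        · rw [if_pos hd, norm_zero]; linarith
        · have hj : j.unpair.1 < n := by
            by_contra hj
            exact hd (digit_eq_of_eq (hn _ (not_lt.1 hj)))
          have h2 := Finset.single_le_sum (f := fun m => ‖S m‖) (fun m _ => norm_nonneg _)
            (Finset.mem_range.2 hj)
          rw [if_neg hd]
          split_ifs
          · linarith
          · rw [norm_neg]; linarith
    refine ⟨A, fun v => N.ext_even_odd (fun j => ?_) fun j => ?_⟩
    · exact (h₀ (digit x) v j).trans ((hA (T (digit y) v) j).1.trans (h₀ (digit y) v j)).symm
    · refine (h₁ (digit x) v j).trans (Eq.symm ((hA (T (digit y) v) j).2.trans ?_))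
      rw [h₀, h₁]
      have := hS j.unpair.1 (M.coord j v)
      cases hx : digit x j <;> cases hy : digit y j <;> simp [this]
  · rintro ⟨A, hA⟩
    have hA : ∀ v, T (digit x) v = A (T (digit y) v) := hA
    obtain ⟨n, hn⟩ := exists_nat_gt (max ‖(A : W →L[𝕜] W)‖ ‖(A.symm : W →L[𝕜] W)‖)
    refine ⟨n, fun m hm => eq_of_digit_eq fun j hj => ?_⟩
    subst hj
    have hnm : (n : ℝ) ≤ (j.unpair.1 : ℝ) := by exact_mod_cast hm
    by_contra hd
    -- The map going from the code with digit 0 to the code with digit 1 is `A.symm` or `A`,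
    -- according to which sequence has the 1.
    cases hx : digit x j <;> cases hy : digit y j
    · exact hd (hx.trans hy.symm)
    · have := lt_norm_of_digits T h₀ h₁ (A.symm : W →L[𝕜] W)
        (fun v => by simp [hA v]) hx hy (hR j.unpair.1)
      linarith [le_max_right ‖(A : W →L[𝕜] W)‖ ‖(A.symm : W →L[𝕜] W)‖]
    · have := lt_norm_of_digits T h₀ h₁ (A : W →L[𝕜] W)
        (fun v => (hA v).symm) hy hx (hR j.unpair.1)
      linarith [le_max_left ‖(A : W →L[𝕜] W)‖ ‖(A.symm : W →L[𝕜] W)‖]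
    · exact hd (hx.trans hy.symm)

end SequenceSpaces

/-! ### The models `ℓ_p(X)` and `c₀(X)` -/

section Models

open Filter Topology

variable (𝕜 : Type*) [RCLike 𝕜] (X : Type*) [NormedAddCommGroup X] [NormedSpace 𝕜 X]

variable {X} in
theorem seqLp_evalCLM_apply (p : ℝ≥0∞) [Fact (1 ≤ p)] (i : ℕ) (v : SeqLp p X) :
    lp.evalCLM 𝕜 (fun _ : ℕ => X) p i v = v i := by
  rw [lp.evalCLM, LinearMap.mkContinuous_apply, lp.evalₗ_apply]

/-- `ℓ_p(X)` as a space of sequences. -/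
noncomputable def seqLpModel (p : ℝ≥0∞) [Fact (1 ≤ p)] (hp : p ≠ ∞) : SeqModel 𝕜 X (SeqLp p X) where
  coord i := lp.evalCLM 𝕜 (fun _ : ℕ => X) p i
  single i := lp.singleContinuousLinearMap 𝕜 (fun _ : ℕ => X) p i
  norm_coord_le i := LinearMap.mkContinuous_norm_le _ zero_le_one _
  norm_single_le i := ContinuousLinearMap.opNorm_le_bound _ zero_le_one fun x => by
    rw [one_mul]
    rw [lp.singleContinuousLinearMap_apply]
    exact (lp.norm_single (E := fun _ : ℕ => X) (zero_lt_one.trans_le Fact.out) i x).le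
  coord_single_same i x := by
    rw [lp.singleContinuousLinearMap_apply, seqLp_evalCLM_apply]
    exact lp.single_apply_self (E := fun _ : ℕ => X) p i x
  coord_single_ne i j x h := by
    rw [lp.singleContinuousLinearMap_apply, seqLp_evalCLM_apply]
    exact lp.single_apply_ne (E := fun _ : ℕ => X) p j x h
  ext v w h := lp.ext (funext fun i => by
    simpa only [seqLp_evalCLM_apply] using h i)
  hasSum_single v := by
    simpa only [lp.singleContinuousLinearMap_apply, seqLp_evalCLM_apply] using lp.hasSum_single hp v

variable {X} in
theorem seqLpModel_coord_apply (p : ℝ≥0∞) [Fact (1 ≤ p)] (hp : p ≠ ∞) (i : ℕ) (v : SeqLp p X) :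
    (seqLpModel 𝕜 X p hp).coord i v = v i := seqLp_evalCLM_apply 𝕜 p i v

theorem seqLpModel_dominates {Y : Type*} [NormedAddCommGroup Y] [NormedSpace 𝕜 Y] (p : ℝ≥0∞)
    [Fact (1 ≤ p)] (hp : p ≠ ∞) : (seqLpModel 𝕜 Y p hp).Dominates (seqLpModel 𝕜 X p hp) := by
  classical
  intro v b σ hσ hb
  simp only [seqLpModel_coord_apply] at hb ⊢
  have hp0 : 0 < p.toReal := ENNReal.toReal_pos (zero_lt_one.trans_le Fact.out).ne' hp
  have hsum : ∀ F : Finset ℕ, ∑ i ∈ F, ‖b i‖ ^ p.toReal ≤ ‖v‖ ^ p.toReal := by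
    intro F
    calc ∑ i ∈ F, ‖b i‖ ^ p.toReal = ∑ i ∈ F with b i ≠ 0, ‖b i‖ ^ p.toReal := by
          refine (Finset.sum_filter_of_ne fun i _ hi => ?_).symm
          intro h0
          exact hi (by rw [h0, norm_zero, Real.zero_rpow hp0.ne'])
      _ ≤ ∑ i ∈ F with b i ≠ 0, ‖v (σ i)‖ ^ p.toReal := by
          gcongr with i _
          exact hb i
      _ = ∑ k ∈ (F.filter fun i => b i ≠ 0).image σ, ‖v k‖ ^ p.toReal := by
          rw [Finset.sum_image]
          exact fun i hi j hj => hσ (Finset.mem_filter.1 hi).2 (Finset.mem_filter.1 hj).2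
      _ ≤ ‖v‖ ^ p.toReal := lp.sum_rpow_le_norm_rpow hp0 v _
  exact ⟨⟨b, memℓp_gen' hsum⟩, fun i => rfl,
    lp.norm_le_of_forall_sum_le hp0 (norm_nonneg _) hsum⟩

variable {X} in
theorem SeqC0.norm_apply_le (v : SeqC0 X) (i : ℕ) : ‖v i‖ ≤ ‖v‖ :=
  v.toBCF.norm_coe_le_norm i

variable {X} in
theorem SeqC0.norm_le {v : SeqC0 X} {C : ℝ} (hC : 0 ≤ C) (h : ∀ i, ‖v i‖ ≤ C) : ‖v‖ ≤ C :=
  (BoundedContinuousFunction.norm_le (f := v.toBCF) hC).2 h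

variable {X} in
theorem SeqC0.finite_le_norm (v : SeqC0 X) {ε : ℝ} (hε : 0 < ε) : {i | ε ≤ ‖v i‖}.Finite := by
  have h := v.zero_at_infty'
  rw [cocompact_eq_cofinite] at h
  have h2 := (Metric.tendsto_nhds.1 h ε hε)
  rw [eventually_cofinite] at h2
  refine h2.subset fun i hi => ?_
  simpa using hi

variable {X} in
/-- A sequence with finite superlevel sets, as an element of `c₀(X)`. -/
def SeqC0.ofFinite (b : ℕ → X) (h : ∀ ε > 0, {i | ε ≤ ‖b i‖}.Finite) : SeqC0 X where
  toFun := b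
  continuous_toFun := continuous_of_discreteTopology
  zero_at_infty' := by
    rw [cocompact_eq_cofinite, Metric.tendsto_nhds]
    intro ε hε
    rw [eventually_cofinite]
    refine (h ε hε).subset fun i hi => ?_
    simpa using hi

/-- Evaluation at `i` on `c₀(X)`. -/
noncomputable def seqC0Coord (i : ℕ) : SeqC0 X →L[𝕜] X :=
  LinearMap.mkContinuous ⟨⟨fun v => v i, fun _ _ => rfl⟩, fun _ _ => rfl⟩ 1
    fun v => by rw [one_mul]; exact SeqC0.norm_apply_le v i

variable {X} in
theorem seqC0Coord_apply (i : ℕ) (v : SeqC0 X) : seqC0Coord 𝕜 X i v = v i :=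
  LinearMap.mkContinuous_apply _ _ _ v

/-- The sequence with the single nonzero entry `x` at `i`. -/
def SeqC0.single (i : ℕ) (x : X) : SeqC0 X :=
  SeqC0.ofFinite (fun j => if j = i then x else 0) fun ε hε =>
    (Set.finite_singleton i).subset fun j (hj : ε ≤ ‖if j = i then x else 0‖) => by
      by_contra hji
      rw [if_neg (by simpa using hji), norm_zero] at hj
      linarith

variable {X} in
theorem SeqC0.single_apply (i j : ℕ) (x : X) :
    SeqC0.single X i x j = if j = i then x else 0 := rfl

/-- The `i`-th coordinate inclusion of `X` into `c₀(X)`. -/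
noncomputable def seqC0Single (i : ℕ) : X →L[𝕜] SeqC0 X :=
  LinearMap.mkContinuous
    { toFun := SeqC0.single X i
      map_add' := fun x y => ZeroAtInftyContinuousMap.ext fun j => by
        rw [ZeroAtInftyContinuousMap.add_apply]
        simp only [SeqC0.single_apply]
        split_ifs <;> simp
      map_smul' := fun c x => ZeroAtInftyContinuousMap.ext fun j => by
        rw [ZeroAtInftyContinuousMap.smul_apply]
        simp only [SeqC0.single_apply]
        split_ifs <;> simp } 1
    fun x => by
      rw [one_mul]
      refine SeqC0.norm_le (norm_nonneg _) fun j => ?_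
      change ‖if j = i then x else 0‖ ≤ ‖x‖
      split_ifs <;> simp

variable {X} in
theorem seqC0Single_apply (i j : ℕ) (x : X) :
    seqC0Single 𝕜 X i x j = if j = i then x else 0 := by
  rw [seqC0Single, LinearMap.mkContinuous_apply]
  rfl

/-- `c₀(X)` as a space of sequences. -/
noncomputable def seqC0Model : SeqModel 𝕜 X (SeqC0 X) where
  coord := seqC0Coord 𝕜 X
  single := seqC0Single 𝕜 X
  norm_coord_le i := LinearMap.mkContinuous_norm_le _ zero_le_one _
  norm_single_le i := LinearMap.mkContinuous_norm_le _ zero_le_one _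
  coord_single_same i x := by rw [seqC0Coord_apply, seqC0Single_apply, if_pos rfl]
  coord_single_ne i j x h := by rw [seqC0Coord_apply, seqC0Single_apply, if_neg h]
  ext v w h := ZeroAtInftyContinuousMap.ext fun i => by
    simpa only [seqC0Coord_apply] using h i
  hasSum_single v := by
    simp only [seqC0Coord_apply]
    refine Metric.tendsto_nhds.2 fun ε hε => ?_
    have hfin := SeqC0.finite_le_norm v (half_pos hε)
    filter_upwards [eventually_ge_atTop hfin.toFinset] with F hF
    rw [dist_eq_norm]
    refine lt_of_le_of_lt (SeqC0.norm_le (half_pos hε).le fun j => ?_) (half_lt_self hε)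
    have hsum : (∑ i ∈ F, seqC0Single 𝕜 X i (v i)) j = if j ∈ F then v j else 0 := by
      rw [← seqC0Coord_apply 𝕜, map_sum]
      simp only [seqC0Coord_apply, seqC0Single_apply, Finset.sum_ite_eq]
    change ‖(∑ i ∈ F, seqC0Single 𝕜 X i (v i)) j - v j‖ ≤ ε / 2
    rw [hsum]
    split_ifs with hj
    · simpa using (half_pos hε).le
    · have : j ∉ hfin.toFinset := fun h => hj (hF h)
      rw [zero_sub, norm_neg]
      simpa using (by simpa using this : ‖v j‖ < ε / 2).le

variable {X} in
theorem seqC0Model_coord_apply (i : ℕ) (v : SeqC0 X) : (seqC0Model 𝕜 X).coord i v = v i :=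
  seqC0Coord_apply 𝕜 i v

theorem seqC0Model_dominates {Y : Type*} [NormedAddCommGroup Y] [NormedSpace 𝕜 Y] :
    (seqC0Model 𝕜 Y).Dominates (seqC0Model 𝕜 X) := by
  intro v b σ hσ hb
  simp only [seqC0Model_coord_apply] at hb ⊢
  refine ⟨SeqC0.ofFinite b fun ε hε => ?_, fun i => rfl,
    SeqC0.norm_le (norm_nonneg _) fun i => (hb i).trans (SeqC0.norm_apply_le v _)⟩
  have hne : ∀ i ∈ {i | ε ≤ ‖b i‖}, b i ≠ 0 := fun i (hi : ε ≤ ‖b i‖) h0 => by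
    rw [h0, norm_zero] at hi
    linarith
  refine Set.Finite.of_finite_image ((SeqC0.finite_le_norm v hε).subset ?_)
    (hσ.mono fun i hi => hne i hi)
  rintro _ ⟨i, hi, rfl⟩
  exact le_trans hi (hb i)

end Models

theorem mainTheorem3 (𝕜 : Type*) [RCLike 𝕜] (X : Type*) [NormedAddCommGroup X] [NormedSpace 𝕜 X]
    [CompleteSpace X] [TopologicalSpace.SeparableSpace X] (hX : ¬ IsUFO 𝕜 X) :
    ∃ Y : Submodule 𝕜 X, IsClosed (Y : Set X) ∧ ¬ FiniteDimensional 𝕜 Y ∧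
      (∀ (p : ℝ≥0∞) [Fact (1 ≤ p)], p ≠ ∞ →
        BorelReducible E₁ (positionSetoid 𝕜 (SeqLp p Y) (SeqLp p X))) ∧
      BorelReducible E₁ (positionSetoid 𝕜 (SeqC0 Y) (SeqC0 X)) := by
  obtain ⟨Y, s, hYc, hY, hs⟩ := exists_subspace_of_not_isUFO hX
  have hXi : ¬ FiniteDimensional 𝕜 X := fun _ => hY inferInstance
  refine ⟨Y, hYc, hY, fun p _ hp => ?_, ?_⟩
  · exact borelReducible_E₁_positionSetoid (seqLpModel 𝕜 Y p hp) (seqLpModel 𝕜 X p hp)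
      (seqLpModel_dominates 𝕜 X p hp) (seqLpModel_dominates 𝕜 Y p hp)
      (seqLpModel_dominates 𝕜 X p hp) hXi Y.subtypeₗᵢ s (fun n => (hs n).1)
      (fun n => (hs n).2.1) fun n => (hs n).2.2
  · exact borelReducible_E₁_positionSetoid (seqC0Model 𝕜 Y) (seqC0Model 𝕜 X)
      (seqC0Model_dominates 𝕜 X) (seqC0Model_dominates 𝕜 Y) (seqC0Model_dominates 𝕜 X) hXi
      Y.subtypeₗᵢ s (fun n => (hs n).1) (fun n => (hs n).2.1) fun n => (hs n).2.2
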